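/- Let $V\in C(\mathbb{R}^2)$ be $\mathbb{Z}^2$-periodic with $0\le V\le 1$, $V=1$ on $B_{1/8}(0)$ and $\operatorname{supp}V\subset\bigcup_{z\in\mathbb{Z}^2}B_{1/4}(z)$, and let $H(y,p)=\tfrac12|p|^2-V(y)$ for $y,p\in\mathbb{R}^2$. Let $D=B_{1/4}\big((\tfrac12,\tfrac12)\big)$, $\Omega=\bigcup_{z\in\mathbb{Z}^2}\big(z+([0,1]^2\setminus\overline D)\big)$ and $\Omega_\varepsilon=\varepsilon\Omega$. For $p\in\mathbb{R}^2$ let $\overline H(p)$ be the constant for which the state-constraint cell problem $$H(y,p+Dv)\le\overline H(p)\ \text{ in }\Omega,\qquad H(y,p+Dv)\ge\overline H(p)\ \text{ on }\overline\Omega$$ has a continuous $\mathbb{Z}^2$-periodic viscosity solution $v$ on $\overline\Omega$. For $\varepsilon>0$ let $u^\varepsilon$ be the viscosity solution, continuous on $\overline{\Omega}_\varepsilon\times[0,\infty)$ and bounded on bounded time intervals, of $$u^\varepsilon_t+H\big(\tfrac{x}{\varepsilon},Du^\varepsilon\big)=0\ \text{ in }\Omega_\varepsilon\times(0,\infty),\qquad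 u^\varepsilon=1\ \text{ on }\partial\Omega_\varepsilon\times(0,\infty),\qquad u^\varepsilon=0\ \text{ on }\overline\Omega_\varepsilon\times\{0\},$$ where the condition on $\partial\Omega_\varepsilon\times(0,\infty)$ is understood in the generalized (viscosity) sense: there, test functions touching from above satisfy $\min\{\varphi_t+H(\tfrac x\varepsilon,D\varphi),\,u^\varepsilon-1\}\le0$ and test functions touching from below satisfy $\max\{\varphi_t+H(\tfrac x\varepsilon,D\varphi),\,u^\varepsilon-1\}\ge0$, touching being relative to $\overline\Omega_\varepsilon\times(0,\infty)$. Let $u$ be the viscosity solution, continuous on $\mathbb{R}^2\times[0,\infty)$ and bounded on bounded time intervals, of $$\max\{u-1,\ u_t+\overline H(Du)\}=0\ \text{ in }\mathbb{R}^2\times(0,\infty),\qquad u=0\ \text{ on }\mathbb{R}^2\times\{0\}.$$ Then, for every $\varepsilon\in(0,1)$, $$u^\varepsilon(0,1)-u(0,1)\ge\frac{\varepsilon}{8}.$$ -/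

import Mathlib

open Set
open scoped Pointwise

noncomputable section

namespace PerforatedHJ

/-- The Euclidean space `ℝⁿ`. -/
abbrev E (n : ℕ) : Type := EuclideanSpace ℝ (Fin n)

variable {n : ℕ}

/-- An element of `ℤⁿ`, seen as a vector of `ℝⁿ`. -/
def latticeVec (z : Fin n → ℤ) : E n := WithLp.toLp 2 (fun i => (z i : ℝ))

/-- Time derivative `φ_t(x,t)` of a function on `ℝⁿ × ℝ`. -/
def timeDeriv (φ : E n × ℝ → ℝ) (x : E n) (t : ℝ) : ℝ :=
  deriv (fun s => φ (x, s)) t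

/-- Spatial gradient `Dφ(x,t)` of a function on `ℝⁿ × ℝ`. -/
def spaceGrad (φ : E n × ℝ → ℝ) (x : E n) (t : ℝ) : E n :=
  gradient (fun y => φ (y, t)) x

/-- `v` is a continuous `ℤⁿ`-periodic viscosity solution of the state-constraint cell problem
`H(y, p + Dv) ≤ c` in `Ω`, `H(y, p + Dv) ≥ c` on the closure of `Ω`. -/
structure IsCellSolution (Ω : Set (E n)) (H : E n → E n → ℝ) (p : E n) (c : ℝ)
    (v : E n → ℝ) : Prop where
  continuousOn : ContinuousOn v (closure Ω)
  periodic : ∀ y ∈ closure Ω, ∀ z : Fin n → ℤ, v (y + latticeVec z) = v y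
  subsolution : ∀ φ : E n → ℝ, ContDiff ℝ 1 φ → ∀ y ∈ Ω,
    IsLocalMaxOn (fun x => v x - φ x) Ω y → H y (p + gradient φ y) ≤ c
  supersolution : ∀ φ : E n → ℝ, ContDiff ℝ 1 φ → ∀ y ∈ closure Ω,
    IsLocalMinOn (fun x => v x - φ x) (closure Ω) y → c ≤ H y (p + gradient φ y)

/-- `Hbar` is the effective Hamiltonian: for every `p`, the number `Hbar p` is a constant for which
the state-constraint cell problem admits a periodic viscosity solution. -/
def IsEffectiveHamiltonian (Ω : Set (E n)) (H : E n → E n → ℝ) (Hbar : E n → ℝ) : Prop :=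
  ∀ p, ∃ v, IsCellSolution Ω H p (Hbar p) v

/-- `u` is a viscosity solution of the Cauchy problem with oscillating Dirichlet data
`u_t + H(x/ε, Du) = 0` in `εΩ × (0,∞)`, `u = b(x, x/ε)` on `∂(εΩ) × (0,∞)`,
`u(·,0) = g` on the closure of `εΩ`. The lateral boundary condition is understood in the
generalized (viscosity) sense; solutions are continuous up to the boundary and bounded on
bounded time intervals. Only the values of `u` on `closure (εΩ) × [0,∞)` matter. -/
structure IsDirichletSolution (Ω : Set (E n)) (H : E n → E n → ℝ) (b : E n → E n → ℝ)
    (g : E n → ℝ) (ε : ℝ) (u : E n → ℝ → ℝ) : Prop where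
  continuousOn : ContinuousOn (fun q : E n × ℝ => u q.1 q.2) (closure (ε • Ω) ×ˢ Ici 0)
  bounded : ∀ T : ℝ, ∃ C : ℝ, ∀ x ∈ closure (ε • Ω), ∀ t ∈ Icc 0 T, |u x t| ≤ C
  initial : ∀ x ∈ closure (ε • Ω), u x 0 = g x
  subsolution : ∀ φ : E n × ℝ → ℝ, ContDiff ℝ 1 φ → ∀ x ∈ ε • Ω, ∀ t : ℝ, 0 < t →
    IsLocalMaxOn (fun q : E n × ℝ => u q.1 q.2 - φ q) (closure (ε • Ω) ×ˢ Ioi 0) (x, t) →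
    timeDeriv φ x t + H (ε⁻¹ • x) (spaceGrad φ x t) ≤ 0
  supersolution : ∀ φ : E n × ℝ → ℝ, ContDiff ℝ 1 φ → ∀ x ∈ ε • Ω, ∀ t : ℝ, 0 < t →
    IsLocalMinOn (fun q : E n × ℝ => u q.1 q.2 - φ q) (closure (ε • Ω) ×ˢ Ioi 0) (x, t) →
    0 ≤ timeDeriv φ x t + H (ε⁻¹ • x) (spaceGrad φ x t)
  boundary_sub : ∀ φ : E n × ℝ → ℝ, ContDiff ℝ 1 φ → ∀ x ∈ frontier (ε • Ω), ∀ t : ℝ, 0 < t →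
    IsLocalMaxOn (fun q : E n × ℝ => u q.1 q.2 - φ q) (closure (ε • Ω) ×ˢ Ioi 0) (x, t) →
    min (timeDeriv φ x t + H (ε⁻¹ • x) (spaceGrad φ x t)) (u x t - b x (ε⁻¹ • x)) ≤ 0
  boundary_super : ∀ φ : E n × ℝ → ℝ, ContDiff ℝ 1 φ → ∀ x ∈ frontier (ε • Ω), ∀ t : ℝ, 0 < t →
    IsLocalMinOn (fun q : E n × ℝ => u q.1 q.2 - φ q) (closure (ε • Ω) ×ˢ Ioi 0) (x, t) →
    0 ≤ max (timeDeriv φ x t + H (ε⁻¹ • x) (spaceGrad φ x t)) (u x t - b x (ε⁻¹ • x))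

/-- `b̄(x) = min_{z ∈ ∂Ω} b(x,z)`. -/
def bBar (Ω : Set (E n)) (b : E n → E n → ℝ) (x : E n) : ℝ :=
  sInf (b x '' frontier Ω)

/-- `u` is a viscosity solution of `max {u - b̄, u_t + H̄(Du)} = 0` in `ℝⁿ × (0,∞)` with
`u(·,0) = g`, continuous and bounded on bounded time intervals. -/
structure IsLimitSolution (Hbar : E n → ℝ) (bbar : E n → ℝ) (g : E n → ℝ)
    (u : E n → ℝ → ℝ) : Prop where
  continuousOn : ContinuousOn (fun q : E n × ℝ => u q.1 q.2) (univ ×ˢ Ici 0)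
  bounded : ∀ T : ℝ, ∃ C : ℝ, ∀ x, ∀ t ∈ Icc 0 T, |u x t| ≤ C
  initial : ∀ x, u x 0 = g x
  subsolution : ∀ φ : E n × ℝ → ℝ, ContDiff ℝ 1 φ → ∀ x, ∀ t : ℝ, 0 < t →
    IsLocalMaxOn (fun q : E n × ℝ => u q.1 q.2 - φ q) (univ ×ˢ Ioi 0) (x, t) →
    max (u x t - bbar x) (timeDeriv φ x t + Hbar (spaceGrad φ x t)) ≤ 0
  supersolution : ∀ φ : E n × ℝ → ℝ, ContDiff ℝ 1 φ → ∀ x, ∀ t : ℝ, 0 < t →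
    IsLocalMinOn (fun q : E n × ℝ => u q.1 q.2 - φ q) (univ ×ˢ Ioi 0) (x, t) →
    0 ≤ max (u x t - bbar x) (timeDeriv φ x t + Hbar (spaceGrad φ x t))

/-- The potentials of the example: continuous `ℤ²`-periodic functions with values in `[0,1]`,
equal to `1` on `B_{1/8}(0)`, whose support is contained modulo `ℤ²` in `B_{1/4}(0)`. -/
structure IsBumpPotential (V : E 2 → ℝ) : Prop where
  continuous : Continuous V
  periodic : ∀ (y : E 2) (z : Fin 2 → ℤ), V (y + latticeVec z) = V y
  nonneg : ∀ y, 0 ≤ V y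
  le_one : ∀ y, V y ≤ 1
  eq_one : ∀ y ∈ Metric.ball (0 : E 2) (1 / 8), V y = 1
  support : tsupport V ⊆ ⋃ z : Fin 2 → ℤ, Metric.ball (latticeVec z) (1 / 4)

/-- `H(y,p) = |p|²/2 - V(y)`. -/
def mechHamiltonian (V : E 2 → ℝ) (y p : E 2) : ℝ := ‖p‖ ^ 2 / 2 - V y

/-- The removed disk `D = B_{1/4}(x₀)`, `x₀ = (1/2, 1/2)`. -/
def disk : Set (E 2) := Metric.ball !₂[(1 / 2 : ℝ), 1 / 2] (1 / 4)

/-- `Ω = ⋃_{z ∈ ℤ²} (z + ([0,1]² \ closure D))`. -/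
def perforatedPlane : Set (E 2) :=
  ⋃ z : Fin 2 → ℤ, (fun y => latticeVec z + y) '' ({y : E 2 | ∀ i, y i ∈ Icc 0 1} \ closure disk)

end PerforatedHJ

end

open Filter Topology

namespace PerforatedHJ

/-! ### Calculus of separated test functions -/

/-! The gap is the sum of two one-sided bounds, $u(0,1)\le 0$ and
$u^\varepsilon(0,1)\ge\varepsilon/8$. For the first, $V=0$ near $(\tfrac12,0)$, so touching a cell
solution from above there gives $\overline H\ge 0$ (`IsCellSolution.nonneg`). Hence $u_t\le 0$, and
$u$ never exceeds its initial value (`IsLimitSolution.le_zero`). For the second, $u^\varepsilon\ge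
0$ because $V\ge 0$ makes $0$ a subsolution (`IsDirichletSolution.nonneg`). On $B_r(0)$,
$r=\varepsilon/8$, one has $V(x/\varepsilon)=1$, and the cone $r-|x|-r(t-1)^2$, of slope $1$ and
speed at most $2r<\tfrac14$, is a strict subsolution: $2r+\tfrac12-1<0$. It is nonpositive where
$|x|=r$ or $t\in\{0,2\}$, so it stays below $u^\varepsilon$, and equals $r$ at $(0,1)$. Each
comparison is with an explicit smooth barrier. -/

theorem timeDeriv_separated {n : ℕ} (f : E n → ℝ) (g : ℝ → ℝ) (x : E n) (t : ℝ) :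
    timeDeriv (fun q : E n × ℝ => f q.1 + g q.2) x t = deriv g t := by
  simp [timeDeriv]

theorem spaceGrad_separated {n : ℕ} (f : E n → ℝ) (g : ℝ → ℝ) (x : E n) (t : ℝ) :
    spaceGrad (fun q : E n × ℝ => f q.1 + g q.2) x t = gradient f x := by
  simp [spaceGrad, gradient, fderiv_add_const]

theorem contDiff_separated {n : ℕ} {f : E n → ℝ} {g : ℝ → ℝ} (hf : ContDiff ℝ 1 f)
    (hg : ContDiff ℝ 1 g) : ContDiff ℝ 1 (fun q : E n × ℝ => f q.1 + g q.2) :=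
  (hf.comp contDiff_fst).add (hg.comp contDiff_snd)

theorem norm_gradient_eq {n : ℕ} (f : E n → ℝ) (x : E n) :
    ‖gradient f x‖ = ‖fderiv ℝ f x‖ := by
  simp [gradient]

theorem hasFDerivAt_norm_sub_sq {n : ℕ} (a x : E n) :
    HasFDerivAt (fun y : E n => ‖y - a‖ ^ 2) (2 • innerSL ℝ (x - a)) x := by
  simpa using ((hasFDerivAt_id x).sub_const a).norm_sq

theorem norm_gradient_const_mul_norm_sub_sq {n : ℕ} (k : ℝ) (a x : E n) :
    ‖gradient (fun y : E n => k * ‖y - a‖ ^ 2) x‖ = 2 * |k| * ‖x - a‖ := by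
  rw [norm_gradient_eq, ((hasFDerivAt_norm_sub_sq a x).const_mul k).fderiv, norm_smul,
    ← Nat.cast_smul_eq_nsmul ℝ, norm_smul, innerSL_apply_norm]
  simp
  ring

/-- Smoothing the cone makes it an admissible test function without increasing its slope. -/
theorem norm_gradient_smoothedNorm_le {n : ℕ} {s : ℝ} (hs : 0 < s) (r : ℝ) (x : E n) :
    ‖gradient (fun y : E n => r - √(‖y‖ ^ 2 + s ^ 2)) x‖ ≤ 1 := by
  have hpos : 0 < ‖x‖ ^ 2 + s ^ 2 := by positivity
  have h0 : HasFDerivAt (fun y : E n => ‖y‖ ^ 2 + s ^ 2) (2 • innerSL ℝ x) x := by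
    simpa using (hasFDerivAt_norm_sub_sq 0 x).add_const (s ^ 2)
  rw [norm_gradient_eq, ((h0.sqrt hpos.ne').const_sub r).fderiv, norm_neg, norm_smul,
    ← Nat.cast_smul_eq_nsmul ℝ, norm_smul, innerSL_apply_norm]
  have hsq : 0 < √(‖x‖ ^ 2 + s ^ 2) := Real.sqrt_pos.2 hpos
  have hle : ‖x‖ ≤ √(‖x‖ ^ 2 + s ^ 2) := Real.le_sqrt_of_sq_le (by nlinarith)
  rw [Real.norm_of_nonneg (by positivity), Real.norm_of_nonneg (by positivity)]
  push_cast
  rw [div_mul_eq_mul_div, div_le_one (by positivity)]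
  linarith

/-! ### Interior minima in cylinders -/

/-- A continuous function which is negative at the centre of a cylinder and nonnegative on its
parabolic boundary and its top has a negative local minimum inside. -/
theorem exists_isLocalMinOn_cylinder {n : ℕ} {S : Set (E n)} (hS : IsClosed S)
    {F : E n × ℝ → ℝ} (hF : ContinuousOn F (S ×ˢ Ici 0)) {x₀ : E n} {t₀ R T : ℝ}
    (hx₀ : x₀ ∈ S) (hR : 0 ≤ R) (ht₀ : t₀ ∈ Icc 0 T) (hneg : F (x₀, t₀) < 0)
    (hbot : ∀ x ∈ S, ‖x - x₀‖ ≤ R → 0 ≤ F (x, 0))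
    (htop : ∀ x ∈ S, ‖x - x₀‖ ≤ R → 0 ≤ F (x, T))
    (hside : ∀ x ∈ S, ‖x - x₀‖ = R → ∀ t ∈ Icc 0 T, 0 ≤ F (x, t)) :
    ∃ x ∈ S, ∃ t, ‖x - x₀‖ < R ∧ 0 < t ∧ t < T ∧ F (x, t) < 0 ∧
      IsLocalMinOn F (S ×ˢ Ioi 0) (x, t) := by
  have hK : IsCompact ((S ∩ Metric.closedBall x₀ R) ×ˢ Icc (0 : ℝ) T) :=
    ((isCompact_closedBall x₀ R).inter_left hS).prod isCompact_Icc
  have hmem : (x₀, t₀) ∈ (S ∩ Metric.closedBall x₀ R) ×ˢ Icc (0 : ℝ) T :=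
    ⟨⟨hx₀, Metric.mem_closedBall_self hR⟩, ht₀⟩
  obtain ⟨⟨x, t⟩, ⟨⟨hxS, hxR⟩, ht0, htT⟩, hmin⟩ := hK.exists_isMinOn ⟨_, hmem⟩
    (hF.mono (prod_mono inter_subset_left Icc_subset_Ici_self))
  simp only at hxS hxR ht0 htT
  have hlt : F (x, t) < 0 := (hmin hmem).trans_lt hneg
  rw [mem_closedBall_iff_norm] at hxR
  have h1 : ‖x - x₀‖ < R := lt_of_le_of_ne hxR fun h =>
    absurd (hside x hxS h t ⟨ht0, htT⟩) (not_le.2 hlt)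
  have h2 : 0 < t := lt_of_le_of_ne ht0 fun h => by
    subst h; exact absurd (hbot x hxS hxR) (not_le.2 hlt)
  have h3 : t < T := lt_of_le_of_ne htT fun h => by
    subst h; exact absurd (htop x hxS hxR) (not_le.2 hlt)
  refine ⟨x, hxS, t, h1, h2, h3, hlt, ?_⟩
  have hnhds : Metric.ball x₀ R ×ˢ Ioo 0 T ∈ 𝓝 (x, t) :=
    (Metric.isOpen_ball.prod isOpen_Ioo).mem_nhds ⟨mem_ball_iff_norm.2 h1, h2, h3⟩
  filter_upwards [mem_nhdsWithin_of_mem_nhds hnhds, self_mem_nhdsWithin] with q hq hqS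
  exact hmin ⟨⟨hqS.1, Metric.ball_subset_closedBall hq.1⟩, Ioo_subset_Icc_self hq.2⟩

/-! ### Geometry of the perforated plane -/

/-- The holes lie at vertical distance at least $1/4$ from the integers. -/
theorem mem_perforatedPlane_of_abs_lt {y : E 2} (hy : |y 1| < 1 / 8) : y ∈ perforatedPlane := by
  refine mem_iUnion.2 ⟨fun i => ⌊y i⌋, y - latticeVec fun i => ⌊y i⌋, ⟨fun i => ?_, fun h => ?_⟩,
    by simp⟩
  · have : (y - latticeVec fun i => ⌊y i⌋) i = Int.fract (y i) := by
      simp [latticeVec]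
    rw [this]
    exact ⟨Int.fract_nonneg _, (Int.fract_lt_one _).le⟩
  · have h1 := Metric.closure_ball_subset_closedBall h
    rw [mem_closedBall_iff_norm] at h1
    have h2 := (PiLp.norm_apply_le ((y - latticeVec fun i => ⌊y i⌋) - !₂[(1 / 2 : ℝ), 1 / 2])
      1).trans h1
    simp [latticeVec] at h2
    rw [abs_le] at h2
    rw [abs_lt] at hy
    rcases le_or_gt 0 (y 1) with h0 | h0
    · rw [Int.fract_eq_self.2 ⟨h0, by linarith⟩] at h2
      linarith
    · have hf : Int.fract (y 1) = y 1 + 1 := by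
        rw [← Int.fract_add_one, Int.fract_eq_self.2 ⟨by linarith, by linarith⟩]
      rw [hf] at h2
      linarith

theorem ball_subset_smul_perforatedPlane {ε : ℝ} (hε : 0 < ε) :
    Metric.ball (0 : E 2) (ε / 8) ⊆ ε • perforatedPlane := by
  intro x hx
  rw [mem_ball_zero_iff] at hx
  refine (mem_smul_set_iff_inv_smul_mem₀ hε.ne' _ _).2 (mem_perforatedPlane_of_abs_lt ?_)
  have h1 : |x 1| < ε / 8 := (PiLp.norm_apply_le x 1).trans_lt hx
  rw [PiLp.smul_apply, smul_eq_mul, abs_mul, abs_of_pos (inv_pos.2 hε), inv_mul_lt_iff₀ hε]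
  linarith

theorem IsBumpPotential.eq_zero {V : E 2 → ℝ} (hV : IsBumpPotential V) {y : E 2}
    (hy : |y 0 - 1 / 2| < 1 / 8) : V y = 0 := by
  by_contra h
  obtain ⟨z, hz⟩ := mem_iUnion.1 (hV.support (subset_tsupport V h))
  rw [mem_ball_iff_norm] at hz
  have h2 := (PiLp.norm_apply_le (y - latticeVec z) 0).trans_lt hz
  simp only [latticeVec, PiLp.sub_apply, Real.norm_eq_abs, abs_lt] at h2 hy
  -- The integer `z 0` is within $1/4+1/8<1/2$ of $1/2$, which is impossible.
  have h3 : (z 0 : ℝ) < 1 := by linarith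
  have h4 : (0 : ℝ) < z 0 := by linarith
  have h5 : z 0 < 1 := by exact_mod_cast h3
  have h6 : 0 < z 0 := by exact_mod_cast h4
  omega

/-! ### The effective Hamiltonian is nonnegative -/

theorem IsCellSolution.nonneg {V : E 2 → ℝ} (hV : IsBumpPotential V) {p : E 2} {c : ℝ}
    {v : E 2 → ℝ} (hv : IsCellSolution perforatedPlane (mechHamiltonian V) p c v) : 0 ≤ c := by
  -- The midpoint of a cell edge: around it there is neither hole nor potential.
  set a : E 2 := !₂[(1 / 2 : ℝ), 0] with ha
  have hball : ∀ y ∈ Metric.closedBall a (1 / 16), |y 0 - 1 / 2| < 1 / 8 ∧ |y 1| < 1 / 8 := by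
    intro y hy
    rw [mem_closedBall_iff_norm] at hy
    have h0 := (PiLp.norm_apply_le (y - a) 0).trans hy
    have h1 := (PiLp.norm_apply_le (y - a) 1).trans hy
    simp [ha] at h0 h1
    constructor <;> norm_num <;> linarith
  have hcont : ContinuousOn v (Metric.closedBall a (1 / 16)) :=
    hv.continuousOn.mono fun y hy =>
      subset_closure (mem_perforatedPlane_of_abs_lt (hball y hy).2)
  obtain ⟨C, hC⟩ := (isCompact_closedBall a (1 / 16)).exists_bound_of_continuousOn hcont
  have hamem : a ∈ Metric.closedBall a (1 / 16) := Metric.mem_closedBall_self (by norm_num)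
  have hC0 : 0 ≤ C := (norm_nonneg _).trans (hC a hamem)
  -- Since $256=16^2$, `φ` equals $2C+1$ on the sphere of radius $1/16$, more than the oscillation
  -- of `v`, so the maximum is interior.
  set φ : E 2 → ℝ := fun y => (256 * (2 * C + 1)) * ‖y - a‖ ^ 2 with hφ
  have hφd : ContDiff ℝ 1 φ :=
    contDiff_const.mul ((contDiff_id.sub contDiff_const).norm_sq ℝ)
  obtain ⟨y, hy, hmax⟩ := (isCompact_closedBall a (1 / 16)).exists_isMaxOn ⟨a, hamem⟩
    (hcont.sub hφd.continuous.continuousOn)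
  have hyb := hball y hy
  have hylt : ‖y - a‖ < 1 / 16 := by
    refine lt_of_le_of_ne (mem_closedBall_iff_norm.1 hy) fun h => ?_
    have h1 : v a - φ a ≤ v y - φ y := hmax hamem
    have h2 := abs_le.1 (hC a hamem)
    have h3 := abs_le.1 (hC y hy)
    simp only [hφ, h, sub_self, norm_zero] at h1
    norm_num at h1
    linarith
  have hloc : IsLocalMaxOn (fun x => v x - φ x) perforatedPlane y := by
    have : Metric.ball a (1 / 16) ∈ 𝓝 y :=
      Metric.isOpen_ball.mem_nhds (mem_ball_iff_norm.2 hylt)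
    filter_upwards [mem_nhdsWithin_of_mem_nhds this] with q hq
    exact hmax (Metric.ball_subset_closedBall hq)
  have h := hv.subsolution φ hφd y (mem_perforatedPlane_of_abs_lt hyb.2) hloc
  rw [mechHamiltonian, hV.eq_zero hyb.1] at h
  have : 0 ≤ ‖p + gradient φ y‖ ^ 2 / 2 := by positivity
  linarith

/-! ### An upper bound for the limit problem -/

theorem contDiff_exp_barrier (δ l t₀ : ℝ) :
    ContDiff ℝ 1 (fun t : ℝ => δ * Real.exp (l * (t - t₀))) := by
  fun_prop

theorem deriv_exp_barrier (δ l t₀ t : ℝ) :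
    deriv (fun t : ℝ => δ * Real.exp (l * (t - t₀))) t = δ * (Real.exp (l * (t - t₀)) * l) := by
  have h : HasDerivAt (fun t : ℝ => l * (t - t₀)) l t := by
    simpa using ((hasDerivAt_id t).sub_const t₀).const_mul l
  exact (h.exp.const_mul δ).deriv

/-- At one unit of time after `t₀` the exponential barrier exceeds `C`. -/
theorem le_exp_barrier {δ C t₀ : ℝ} (hδ : 0 < δ) :
    C ≤ δ * Real.exp (C / δ * (t₀ + 1 - t₀)) := by
  have h1 := Real.add_one_le_exp (C / δ * (t₀ + 1 - t₀))
  have h2 := mul_le_mul_of_nonneg_left h1 hδ.le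
  have h3 : δ * (C / δ * (t₀ + 1 - t₀) + 1) = C + δ := by field_simp; ring
  linarith

theorem IsLimitSolution.le_zero {n : ℕ} {Hbar bbar : E n → ℝ} {u : E n → ℝ → ℝ}
    (hH : ∀ p, 0 ≤ Hbar p) (hu : IsLimitSolution Hbar bbar (fun _ => 0) u) (x₀ : E n) {t₀ : ℝ}
    (ht₀ : 0 ≤ t₀) : u x₀ t₀ ≤ 0 := by
  by_contra! hpos
  obtain ⟨C₀, hC₀⟩ := hu.bounded (t₀ + 1)
  set C : ℝ := max C₀ 1 with hCdef
  have hC1 : 0 < C := lt_max_of_lt_right one_pos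
  have hC : ∀ x, ∀ t ∈ Icc 0 (t₀ + 1), u x t ≤ C := fun x t ht =>
    (le_abs_self _).trans ((hC₀ x t ht).trans (le_max_left _ _))
  set δ : ℝ := u x₀ t₀ / 2 with hδdef
  have hδ : 0 < δ := by positivity
  -- As `Hbar` is nonnegative at every gradient, the paraboloid may be steep and radius $1$
  -- suffices; the exponential supplies strict growth in time and covers the top.
  set f : E n → ℝ := fun x => C * ‖x - x₀‖ ^ 2 with hf
  set g : ℝ → ℝ := fun t => δ * Real.exp (C / δ * (t - t₀)) with hg
  have hfd : ContDiff ℝ 1 f := contDiff_const.mul ((contDiff_id.sub contDiff_const).norm_sq ℝ)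
  have hφ : ContDiff ℝ 1 (fun q : E n × ℝ => f q.1 + g q.2) :=
    contDiff_separated hfd (contDiff_exp_barrier δ (C / δ) t₀)
  have hf0 : ∀ x, 0 ≤ f x := fun x => by positivity
  have hg0 : ∀ t, 0 < g t := fun t => by positivity
  obtain ⟨x, -, t, -, ht, -, -, hmin⟩ := exists_isLocalMinOn_cylinder (S := univ)
    (F := fun q => f q.1 + g q.2 - u q.1 q.2) isClosed_univ
    (hφ.continuous.continuousOn.sub hu.continuousOn) (x₀ := x₀) (t₀ := t₀) (R := 1)
    (T := t₀ + 1) (mem_univ _) zero_le_one ⟨ht₀, by linarith⟩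
    (by simp [hf, hg]; linarith)
    (fun x _ _ => by
      simp only [hu.initial x]
      linarith [hf0 x, hg0 0])
    (fun x _ _ => by
      have h1 := hC x (t₀ + 1) ⟨by linarith, le_rfl⟩
      have h2 : C ≤ g (t₀ + 1) := le_exp_barrier hδ
      simp only
      linarith [hf0 x])
    (fun x _ hx t ht => by
      have h1 := hC x t ht
      simp only [hf, hx]
      linarith [hg0 t])
  have hmax : IsLocalMaxOn (fun q : E n × ℝ => u q.1 q.2 - (f q.1 + g q.2)) (univ ×ˢ Ioi 0)
      (x, t) := by
    simpa using hmin.neg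
  have h := (le_max_right _ _).trans (hu.subsolution _ hφ x t ht hmax)
  rw [timeDeriv_separated, deriv_exp_barrier] at h
  have h1 : 0 < δ * (Real.exp (C / δ * (t - t₀)) * (C / δ)) := by positivity
  linarith [hH (spaceGrad (fun q : E n × ℝ => f q.1 + g q.2) x t)]

/-! ### Lower bounds for the oscillating problem -/

theorem IsDirichletSolution.nonneg {V : E 2 → ℝ} (hV : ∀ y, 0 ≤ V y) {Ω : Set (E 2)} {ε : ℝ}
    {u : E 2 → ℝ → ℝ}
    (hu : IsDirichletSolution Ω (mechHamiltonian V) (fun _ _ => 1) (fun _ => 0) ε u)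
    {x₀ : E 2} (hx₀ : x₀ ∈ closure (ε • Ω)) {t₀ : ℝ} (ht₀ : 0 ≤ t₀) : 0 ≤ u x₀ t₀ := by
  by_contra! hneg
  obtain ⟨C₀, hC₀⟩ := hu.bounded (t₀ + 1)
  set C : ℝ := max C₀ 1 with hCdef
  have hC1 : 0 < C := lt_max_of_lt_right one_pos
  have hC : ∀ x ∈ closure (ε • Ω), ∀ t ∈ Icc 0 (t₀ + 1), -C ≤ u x t := fun x hx t ht =>
    (abs_le.1 ((hC₀ x hx t ht).trans (le_max_left _ _))).1
  set δ : ℝ := -u x₀ t₀ / 2 with hδdef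
  have hδ : 0 < δ := by rw [hδdef]; linarith
  -- a lower bound for the speed of the barrier
  set m : ℝ := δ * (Real.exp (C / δ * (0 - t₀)) * (C / δ)) with hm
  have hm0 : 0 < m := by positivity
  -- Here the gradient counts against the barrier: on the ball it is at most $2C/R$, and this `R`
  -- makes its energy $2C^2/R^2$ smaller than `m`.
  set R : ℝ := 2 * C ^ 2 / m + 1 with hRdef
  have hR1 : 1 ≤ R := by
    have : 0 ≤ 2 * C ^ 2 / m := by positivity
    linarith
  have hR0 : 0 < R := by linarith
  set k : ℝ := -(C / R ^ 2) with hk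
  have hk0 : k ≤ 0 := by rw [hk]; linarith [show 0 ≤ C / R ^ 2 by positivity]
  set f : E 2 → ℝ := fun x => k * ‖x - x₀‖ ^ 2 with hf
  set g : ℝ → ℝ := fun t => -δ * Real.exp (C / δ * (t - t₀)) with hg
  have hfd : ContDiff ℝ 1 f := contDiff_const.mul ((contDiff_id.sub contDiff_const).norm_sq ℝ)
  have hφ : ContDiff ℝ 1 (fun q : E 2 × ℝ => f q.1 + g q.2) :=
    contDiff_separated hfd (contDiff_exp_barrier (-δ) (C / δ) t₀)
  have hf0 : ∀ x, f x ≤ 0 := fun x => mul_nonpos_of_nonpos_of_nonneg hk0 (sq_nonneg _)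
  have hg0 : ∀ t, g t < 0 := fun t => mul_neg_of_neg_of_pos (by linarith) (Real.exp_pos _)
  obtain ⟨x, hx, t, hxR, ht, htT, hlt, hmin⟩ := exists_isLocalMinOn_cylinder
    (S := closure (ε • Ω)) (F := fun q => u q.1 q.2 - (f q.1 + g q.2)) isClosed_closure
    (hu.continuousOn.sub hφ.continuous.continuousOn) (x₀ := x₀) (t₀ := t₀) (R := R)
    (T := t₀ + 1) hx₀ hR0.le ⟨ht₀, by linarith⟩
    (by simp [hf, hg]; linarith)
    (fun x hx _ => by
      simp only [hu.initial x hx]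
      linarith [hf0 x, hg0 0])
    (fun x hx _ => by
      have h1 := hC x hx (t₀ + 1) ⟨by linarith, le_rfl⟩
      have h2 : C ≤ δ * Real.exp (C / δ * (t₀ + 1 - t₀)) := le_exp_barrier hδ
      have h3 : g (t₀ + 1) ≤ -C := by simp only [hg]; linarith
      simp only
      linarith [hf0 x])
    (fun x hx hxR t ht => by
      have h1 := hC x hx t ht
      have h2 : f x = -C := by
        simp only [hf, hxR, hk]
        field_simp
      simp only [h2]
      linarith [hg0 t])
  have hu1 : u x t < 0 := by
    simp only at hlt
    linarith [hf0 x, hg0 t]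
  have h : 0 ≤ timeDeriv (fun q : E 2 × ℝ => f q.1 + g q.2) x t +
      mechHamiltonian V (ε⁻¹ • x) (spaceGrad (fun q : E 2 × ℝ => f q.1 + g q.2) x t) := by
    by_cases hxf : x ∈ frontier (ε • Ω)
    -- At the contact point $u<0<1$, so the Dirichlet alternative fails and the equation holds up to
    -- the boundary.
    · refine (le_max_iff.1 (hu.boundary_super _ hφ x hxf t ht hmin)).resolve_right ?_
      linarith
    · have hxi : x ∈ ε • Ω := by
        by_contra hxn
        exact hxf ⟨hx, fun hi => hxn (interior_subset hi)⟩
      exact hu.supersolution _ hφ x hxi t ht hmin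
  rw [timeDeriv_separated, deriv_exp_barrier, spaceGrad_separated, mechHamiltonian,
    norm_gradient_const_mul_norm_sub_sq] at h
  have h1 : m ≤ δ * (Real.exp (C / δ * (t - t₀)) * (C / δ)) := by
    rw [hm]
    have : C / δ * (0 - t₀) ≤ C / δ * (t - t₀) :=
      mul_le_mul_of_nonneg_left (by linarith) (by positivity)
    gcongr
  have h2 : 2 * |k| * ‖x - x₀‖ ≤ 2 * C / R := by
    have : |k| = C / R ^ 2 := by rw [hk, abs_neg, abs_of_pos (by positivity)]
    rw [this]
    calc 2 * (C / R ^ 2) * ‖x - x₀‖ ≤ 2 * (C / R ^ 2) * R := by gcongr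
      _ = 2 * C / R := by field_simp
  have h3 : (2 * |k| * ‖x - x₀‖) ^ 2 / 2 ≤ (2 * C / R) ^ 2 / 2 := by gcongr
  have h4 : (2 * C / R) ^ 2 / 2 < m := by
    have h5 : 2 * C ^ 2 < m * R := by
      rw [hRdef, mul_add, mul_div_cancel₀ _ hm0.ne']
      linarith
    have h6 : m * R ≤ m * R ^ 2 := by
      refine mul_le_mul_of_nonneg_left ?_ hm0.le
      nlinarith
    rw [div_pow, div_div, div_lt_iff₀ (by positivity)]
    linarith
  linarith [hV (ε⁻¹ • x)]

theorem IsDirichletSolution.le_apply_zero_one {V : E 2 → ℝ} (hV : IsBumpPotential V) {ε : ℝ}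
    (hε : ε ∈ Ioo (0 : ℝ) 1) {u : E 2 → ℝ → ℝ}
    (hu : IsDirichletSolution perforatedPlane (mechHamiltonian V) (fun _ _ => 1) (fun _ => 0)
      ε u) : ε / 8 ≤ u 0 1 := by
  obtain ⟨hε0, hε1⟩ := hε
  have hball := ball_subset_smul_perforatedPlane hε0
  have h0mem : (0 : E 2) ∈ closure (ε • perforatedPlane) :=
    subset_closure (hball (Metric.mem_ball_self (by positivity)))
  -- The slack `s` is also the smoothing parameter: the barrier equals $r-s$ at $(0,1)$.
  refine le_of_forall_pos_le_add fun s hs => ?_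
  by_contra! hcon
  set r : ℝ := ε / 8 with hr
  have hr0 : 0 < r := by positivity
  set f : E 2 → ℝ := fun x => r - √(‖x‖ ^ 2 + s ^ 2) with hf
  set g : ℝ → ℝ := fun t => -r * (t - 1) ^ 2 with hg
  have hfd : ContDiff ℝ 1 f := by
    refine contDiff_const.sub (ContDiff.sqrt ?_ fun x => by positivity)
    exact (contDiff_id.norm_sq ℝ).add contDiff_const
  have hgd : ContDiff ℝ 1 g := by fun_prop
  have hφ := contDiff_separated hfd hgd
  have hfr : ∀ x, f x ≤ r - ‖x‖ := fun x => by
    have : ‖x‖ ≤ √(‖x‖ ^ 2 + s ^ 2) := Real.le_sqrt_of_sq_le (by nlinarith)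
    simp only [hf]
    linarith
  have hg0 : ∀ t, g t ≤ 0 := fun t =>
    mul_nonpos_of_nonpos_of_nonneg (by linarith) (sq_nonneg _)
  obtain ⟨x, -, t, hxR, ht, -, -, hmin⟩ := exists_isLocalMinOn_cylinder
    (S := closure (ε • perforatedPlane)) (F := fun q => u q.1 q.2 - (f q.1 + g q.2))
    isClosed_closure (hu.continuousOn.sub hφ.continuous.continuousOn) (x₀ := 0) (t₀ := 1)
    (R := r) (T := 2) h0mem hr0.le ⟨by norm_num, by norm_num⟩
    (by simp [hf, hg, Real.sqrt_sq hs.le]; linarith)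
    (fun x hx _ => by
      have h1 := hu.nonneg hV.nonneg hx le_rfl
      have h2 : g 0 = -r := by simp [hg]
      simp only [h2]
      linarith [hfr x, norm_nonneg x])
    (fun x hx _ => by
      have h1 := hu.nonneg hV.nonneg hx zero_le_two
      have h2 : g 2 = -r := by simp only [hg]; ring
      simp only [h2]
      linarith [hfr x, norm_nonneg x])
    (fun x hx hxR t ht => by
      have h1 := hu.nonneg hV.nonneg hx ht.1
      rw [sub_zero] at hxR
      simp only
      linarith [hfr x, hg0 t])
  rw [sub_zero] at hxR
  have h := hu.supersolution _ hφ x (hball (mem_ball_zero_iff.2 hxR)) t ht hmin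
  have hVx : V (ε⁻¹ • x) = 1 := by
    refine hV.eq_one _ (mem_ball_zero_iff.2 ?_)
    rw [norm_smul, norm_inv, Real.norm_of_nonneg hε0.le, inv_mul_lt_iff₀ hε0]
    linarith
  have hgt : deriv g t = -r * (2 * (t - 1)) := by
    have h1 : HasDerivAt (fun t : ℝ => (t - 1) ^ 2) (2 * (t - 1)) t := by
      simpa using ((hasDerivAt_id t).sub_const 1).fun_pow 2
    exact (h1.const_mul (-r)).deriv
  rw [timeDeriv_separated, spaceGrad_separated, mechHamiltonian, hVx, hgt] at h
  have h1 := norm_gradient_smoothedNorm_le hs r x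
  have h2 : ‖gradient f x‖ ^ 2 ≤ 1 := pow_le_one₀ (norm_nonneg _) h1
  have h3 : -r * (2 * (t - 1)) ≤ 2 * r := by nlinarith
  linarith

end PerforatedHJ

theorem mainTheorem4
    (V : PerforatedHJ.E 2 → ℝ) (hV : PerforatedHJ.IsBumpPotential V)
    (Hbar : PerforatedHJ.E 2 → ℝ)
    (hHbar : PerforatedHJ.IsEffectiveHamiltonian PerforatedHJ.perforatedPlane
      (PerforatedHJ.mechHamiltonian V) Hbar)
    (u : PerforatedHJ.E 2 → ℝ → ℝ)
    (hu : PerforatedHJ.IsLimitSolution Hbar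
      (PerforatedHJ.bBar PerforatedHJ.perforatedPlane (fun _ _ => 1)) (fun _ => 0) u)
    (ε : ℝ) (hε : ε ∈ Set.Ioo (0 : ℝ) 1)
    (uε : PerforatedHJ.E 2 → ℝ → ℝ)
    (huε : PerforatedHJ.IsDirichletSolution PerforatedHJ.perforatedPlane
      (PerforatedHJ.mechHamiltonian V) (fun _ _ => 1) (fun _ => 0) ε uε) :
    uε 0 1 - u 0 1 ≥ ε / 8 := by
  have hH : ∀ p, 0 ≤ Hbar p := fun p => by
    obtain ⟨v, hv⟩ := hHbar p
    exact hv.nonneg hV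
  have h1 := hu.le_zero hH 0 zero_le_one
  have h2 := huε.le_apply_zero_one hV hε
  linarith
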